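/- Let $F$ be a field. An affine (resp. projective) subspace arrangement $\mathcal A$ is a finite collection of proper subspaces of the affine space $F^n$ (resp. of the projective space $F\mathbb P^{n-1}$, $n\ge 1$); it is $d$-dimensional if $d\ge 0$ is the maximal dimension of its members. Let $L_{\mathcal A}$ be its intersection semilattice: the set of all nonempty intersections of subfamilies of $\mathcal A$ (including the whole space $\hat 0$, the empty intersection), ordered by reverse inclusion, with Möbius function $\mu$. The characteristic polynomial of an affine arrangement is $P_{\mathcal A}(t)=\sum_{x\in L_{\mathcal A}}\mu(\hat 0,x)\,t^{\dim x}$, and the reduced characteristic polynomial of a projective arrangement is $P^*_{\mathcal A}(t)=\sum_{x\in L_{\mathcal A}}\mu(\hat 0,x)\,(1+t+\cdots+t^{\dim x})$. Call $L_{\mathcal A}$ hereditary if for every $x\in L_{\mathcal A}\setminus\{\hat 0\}$ with $\dim x>0$ there is $y\in L_{\mathcal A}$ with $y>x$ and $\dim y=\dim x-1$; mod-$2$-pure if either all its maximal chains have even length or all have odd length; and CL-shellable if the bounded poset obtained from $L_{\mathcal A}$ by adding a new greatest element admits a CL-labeling (in the sense of Björner and Wachs, for not necessarily pure posets). Suppose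 that $L_{\mathcal A}$ is hereditary, mod-$2$-pure and CL-shellable. (1) If $\mathcal A$ is affine and $d$-dimensional, then its characteristic polynomial has the form $P_{\mathcal A}(t)=\sum_{j=0}^d c_jt^j+t^n$, and $(-1)^{d-j}c_j\le 0$ for all $0\le j\le d$. (2) If $\mathcal A$ is projective and $d$-dimensional, then its reduced characteristic polynomial has the form $P^*_{\mathcal A}(t)=\sum_{j=0}^d c_jt^j+\sum_{j=d+1}^{n-1}t^j$, and $(-1)^{d-j}c_j\le 0$ for all $0\le j\le d$. -/

import Mathlib

open Polynomial

noncomputable section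

namespace SubspaceArrangement

/-! ### Finite bounded posets: CL-labelings -/

section CL

variable {P Λ : Type*}

/-- `c` lists the elements after `x` of a maximal chain `x ⋖ c₁ ⋖ ⋯ ⋖ c_k = y` of `[x, y]`
(so `c = []` exactly for `x = y`). -/
def IsSaturated [Preorder P] (x : P) (c : List P) (y : P) : Prop :=
  List.IsChain (· ⋖ ·) (x :: c) ∧ (x :: c).getLast (List.cons_ne_nil x c) = y

/-- The word of labels read along the chain `c` when `c` is reached along the root `r`.
A chain-edge labeling attaches a label to each edge of each maximal chain of `P`, in such a way that
two maximal chains with the same first `k` edges have the same first `k` labels. The label of an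
edge is thus a function of the part of the maximal chain up to this edge: `lab r z` is the label of
the edge that leads from the end of the chain `r` (which starts at the least element, not listed) to
the element `z`. -/
def labelWord (lab : List P → P → Λ) : List P → List P → List Λ
  | _, [] => []
  | r, z :: c => lab r z :: labelWord lab (r ++ [z]) c

/-- `lab` is a CL-labeling of the bounded poset `P`: in each rooted interval `[x, y]_r`, where
`x < y` and `r` is a maximal chain of `[0̂, x]`, there is exactly one maximal chain whose labels
are strictly increasing, and its word of labels lexicographically precedes the words of labels of
all other maximal chains of `[x, y]_r`. -/
def IsCLLabeling [PartialOrder P] [BoundedOrder P] [PartialOrder Λ]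
    (lab : List P → P → Λ) : Prop :=
  ∀ (x y : P) (r : List P), x < y → IsSaturated ⊥ r x →
    ∃ c : List P, IsSaturated x c y ∧ (labelWord lab r c).IsChain (· < ·) ∧
      ∀ c' : List P, IsSaturated x c' y → c' ≠ c →
        ¬ (labelWord lab r c').IsChain (· < ·) ∧
          List.Lex (· < ·) (labelWord lab r c) (labelWord lab r c')

/-- A finite bounded poset is CL-shellable if it has a CL-labeling, with labels in some poset.
(Only finitely many labels matter, so label posets in `Type` are general enough.) -/
def IsCLShellable (P : Type*) [PartialOrder P] [BoundedOrder P] : Prop :=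
  ∃ (Λ : Type) (_ : PartialOrder Λ) (lab : List P → P → Λ), IsCLLabeling lab

end CL

/-- A poset is mod-2-pure if all its maximal chains have even length or all have odd length
(the length of a chain is its number of elements minus one). -/
def IsModTwoPure (L : Type*) [PartialOrder L] : Prop :=
  (∀ s : Set L, IsMaxChain (· ≤ ·) s → Even (s.ncard - 1)) ∨
    (∀ s : Set L, IsMaxChain (· ≤ ·) s → Odd (s.ncard - 1))

/-! ### The intersection semilattice

`X` is the lattice of all affine (or projective) subspaces of a space, including the empty
subspace `⊥` and the whole space `⊤`; its infima are intersections. -/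

section Semilattice

variable {X : Type*} [CompleteLattice X]

/-- The intersection semilattice: all nonempty intersections of subarrangements, where the empty
subarrangement yields the whole space. -/
def IntersectionSemilattice (A : Finset X) : Type _ :=
  {x : X // x ≠ ⊥ ∧ ∃ B : Set X, B ⊆ ↑A ∧ sInf B = x}

/-- The order is reverse inclusion. -/
instance (A : Finset X) : PartialOrder (IntersectionSemilattice A) where
  le x y := y.1 ≤ x.1
  le_refl x := le_refl x.1
  le_trans _ _ _ h₁ h₂ := le_trans h₂ h₁
  le_antisymm _ _ h₁ h₂ := Subtype.ext (le_antisymm h₂ h₁)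

/-- The least element is the whole space. -/
instance [Nontrivial X] (A : Finset X) : OrderBot (IntersectionSemilattice A) where
  bot := ⟨⊤, top_ne_bot, ∅, Set.empty_subset _, sInf_empty⟩
  bot_le x := (le_top : x.1 ≤ ⊤)

instance (A : Finset X) : Finite (IntersectionSemilattice A) := by
  have h : {x : X | x ≠ ⊥ ∧ ∃ B : Set X, B ⊆ ↑A ∧ sInf B = x}.Finite :=
    (A.finite_toSet.finite_subsets.image sInf).subset
      (fun x ⟨_, B, hB, hx⟩ => ⟨B, hB, hx⟩)
  exact h.to_subtype

instance (A : Finset X) : Fintype (IntersectionSemilattice A) := Fintype.ofFinite _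

instance (A : Finset X) : DecidableEq (IntersectionSemilattice A) := Classical.decEq _

instance (A : Finset X) : LocallyFiniteOrder (IntersectionSemilattice A) := by
  classical exact Fintype.toLocallyFiniteOrder

/-- `A` is a `d`-dimensional arrangement if `d` is the maximal dimension of its
(nonempty) members. -/
def IsDimensional (dim : X → ℕ) (A : Finset X) (d : ℕ) : Prop :=
  (∃ K ∈ A, K ≠ ⊥ ∧ dim K = d) ∧ ∀ K ∈ A, K ≠ ⊥ → dim K ≤ d

variable [Nontrivial X]

/-- The intersection semilattice is hereditary: if `x ≠ 0̂` has positive dimension, then some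
`y > x` has dimension `dim x - 1`. -/
def IsHereditary (dim : X → ℕ) (A : Finset X) : Prop :=
  ∀ x : IntersectionSemilattice A, x ≠ ⊥ → 0 < dim x.1 →
    ∃ y : IntersectionSemilattice A, x < y ∧ dim y.1 + 1 = dim x.1

/-- The intersection semilattice is CL-shellable: the bounded poset obtained from it by adding
a new greatest element is CL-shellable. -/
def IsCLShellableArrangement (A : Finset X) : Prop :=
  IsCLShellable (WithTop (IntersectionSemilattice A))

/-- The Möbius function value `μ(0̂, x)` of the intersection semilattice. -/
def mobius (A : Finset X) (x : IntersectionSemilattice A) : ℤ :=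
  IncidenceAlgebra.mu ℤ (⊥ : IntersectionSemilattice A) x

end Semilattice

/-! ### Affine and projective arrangements -/

section Field

variable {F : Type*} [Field F] {n : ℕ}

/-- The dimension of a (nonempty) affine subspace of `Fⁿ`. -/
def affineDim (K : AffineSubspace F (Fin n → F)) : ℕ := Module.finrank F K.direction

/-- The characteristic polynomial `∑ₓ μ(0̂, x) t ^ dim x` of an affine arrangement in `Fⁿ`. -/
def charPoly (A : Finset (AffineSubspace F (Fin n → F))) : ℤ[X] :=
  ∑ x : IntersectionSemilattice A, C (mobius A x) * X ^ affineDim x.1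

/-- The dimension of a (nonempty) projective subspace: one less than the dimension of the
corresponding linear subspace. -/
def projDim (K : Projectivization.Subspace F (Fin n → F)) : ℕ :=
  Module.finrank F (Projectivization.Subspace.submodule K) - 1

instance [NeZero n] : Nontrivial (Projectivization.Subspace F (Fin n → F)) :=
  (Projectivization.Subspace.submodule (K := F) (V := Fin n → F)).toEquiv.nontrivial

/-- The reduced characteristic polynomial `∑ₓ μ(0̂, x) (1 + t + ⋯ + t ^ dim x)` of a projective
arrangement in projective `(n - 1)`-space. -/
def reducedCharPoly [NeZero n] (A : Finset (Projectivization.Subspace F (Fin n → F))) : ℤ[X] :=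
  ∑ x : IntersectionSemilattice A,
    C (mobius A x) * ∑ i ∈ Finset.range (projDim x.1 + 1), X ^ i

end Field

end SubspaceArrangement

end

namespace SubspaceArrangement

/-! ### Increasing chains and first atoms in CL-labeled posets. -/

section CL

variable {P Λ : Type*}

/-! For `j ≤ d` the coefficient `c_j` is the sum of `μ(0̂, x)` over `dim x = j` in the affine case
and over `dim x ≥ j` in the projective case; above degree `d` only `0̂` contributes. Both signs come
from one statement on `∑_{y ∈ B} μ(0̂, y)` for a lower set `B`: `B = {y | y < x}` gives `-μ(0̂, x)`,
and `B = {y | dim y ≥ j}` gives the projective coefficient. Such a sum is minus the Möbius number of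
`B` with a top `T` adjoined.

The sign is found by a shelling-type induction (`IsCLLabeling.sign_sum_nonneg`). Take a set `I` of
atoms of a rooted interval that is closed downwards in the labels, and remove an atom `a` of maximal
label. By inclusion-exclusion the upper set of `I` loses the upper set of `a`, except for its
overlap with the rest. By the CL property this overlap is generated by covers of `a`, again closed
downwards in the labels (`exists_cover`, `exists_le_of_lab_lt`), so the induction continues one
level up with the opposite sign.

The induction needs a sign that alternates along covers and equals `1` wherever an increasing chain
to `T` leaves `B` at once. Heredity gives an upper chain whose length is the dimension, so
mod-2-purity makes the parity of the dimension alternate (`dim_mod_two`). Heredity also forces the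
increasing chain to `⊤` to descend by one dimension (`dim_isFirst`), so it leaves `{dim ≥ j}` only
from dimension exactly `j`. -/

theorem isSaturated_nil [Preorder P] {x y : P} : IsSaturated x [] y ↔ x = y := by
  simp [IsSaturated]

theorem isSaturated_cons [Preorder P] {x a y : P} {c : List P} :
    IsSaturated x (a :: c) y ↔ x ⋖ a ∧ IsSaturated a c y := by
  simp [IsSaturated, and_assoc]

theorem IsSaturated.le [Preorder P] {x y : P} {c : List P} (h : IsSaturated x c y) : x ≤ y := by
  induction c generalizing x with
  | nil => exact (isSaturated_nil.1 h).le
  | cons a c ih =>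
    rw [isSaturated_cons] at h
    exact h.1.le.trans (ih h.2)

theorem IsSaturated.snoc [Preorder P] {x y a : P} {c : List P} (h : IsSaturated x c y)
    (hya : y ⋖ a) : IsSaturated x (c ++ [a]) a := by
  induction c generalizing x with
  | nil =>
    rw [isSaturated_nil] at h
    subst h
    exact isSaturated_cons.2 ⟨hya, isSaturated_nil.2 rfl⟩
  | cons b c ih =>
    rw [isSaturated_cons] at h
    exact isSaturated_cons.2 ⟨h.1, ih h.2⟩

/-- `a` is the first element after `x` of a maximal chain of `[x, y]_r` with increasing labels. -/
def IsFirst [Preorder P] [Preorder Λ] (lab : List P → P → Λ) (r : List P) (x a y : P) : Prop :=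
  x ⋖ a ∧ ∃ c, IsSaturated a c y ∧ (labelWord lab r (a :: c)).IsChain (· < ·)

section

variable [PartialOrder P] [PartialOrder Λ] {lab : List P → P → Λ} {r : List P} {x a b y z : P}

theorem IsFirst.le (h : IsFirst lab r x a y) : a ≤ y := by
  obtain ⟨-, c, hc, -⟩ := h
  exact hc.le

theorem IsFirst.tail (h : IsFirst lab r x a y) (hay : a < y) :
    ∃ z, IsFirst lab (r ++ [a]) a z y ∧ lab r a < lab (r ++ [a]) z := by
  obtain ⟨-, c, hc, hinc⟩ := h
  cases c with
  | nil => exact absurd (isSaturated_nil.1 hc) hay.ne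
  | cons z c =>
    rw [isSaturated_cons] at hc
    simp only [labelWord, List.isChain_cons_cons] at hinc
    exact ⟨z, ⟨hc.1, c, hc.2, hinc.2⟩, hinc.1⟩

theorem IsFirst.cons (hxa : x ⋖ a) (h : IsFirst lab (r ++ [a]) a z y)
    (hlt : lab r a < lab (r ++ [a]) z) : IsFirst lab r x a y := by
  obtain ⟨haz, c, hc, hinc⟩ := h
  refine ⟨hxa, z :: c, isSaturated_cons.2 ⟨haz, hc⟩, ?_⟩
  simp only [labelWord, List.isChain_cons_cons] at hinc ⊢
  exact ⟨hlt, hinc⟩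

theorem isFirst_self (hxa : x ⋖ a) : IsFirst lab r x a a :=
  ⟨hxa, [], isSaturated_nil.2 rfl, by simp [labelWord]⟩

variable [BoundedOrder P]

theorem IsCLLabeling.exists_isFirst (hl : IsCLLabeling lab) (hr : IsSaturated ⊥ r x) (hxy : x < y) :
    ∃ a, IsFirst lab r x a y := by
  obtain ⟨c, hc, hinc, -⟩ := hl x y r hxy hr
  cases c with
  | nil => exact absurd (isSaturated_nil.1 hc) hxy.ne
  | cons a c =>
    rw [isSaturated_cons] at hc
    exact ⟨a, hc.1, c, hc.2, hinc⟩

/-- The label of the first edge of the increasing chain is less than the labels of all other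
edges at the bottom of the interval. -/
theorem IsCLLabeling.lab_lt (hl : IsCLLabeling lab) (hr : IsSaturated ⊥ r x) (ha : IsFirst lab r x a y)
    (hxb : x ⋖ b) (hby : b ≤ y) (hne : b ≠ a) : lab r a < lab r b := by
  have hay : a < y := ha.le.lt_of_ne fun h =>
    hne ((h ▸ ha.1).eq_or_eq hxb.le hby |>.resolve_left hxb.ne' |>.trans h.symm)
  have hby' : b < y := hby.lt_of_ne fun h =>
    hne ((h ▸ hxb).eq_or_eq ha.1.le ha.le |>.resolve_left ha.1.ne' |>.symm ▸ h)
  obtain ⟨c₀, -, -, huniq⟩ := hl x y r (ha.1.lt.trans hay) hr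
  obtain ⟨e, he⟩ := hl.exists_isFirst (hr.snoc hxb) hby'
  obtain ⟨hbe, c', hc', hinc'⟩ := he
  obtain ⟨hxa, c, hc, hinc⟩ := ha
  have hc0 : a :: c = c₀ := by
    by_contra hn
    exact (huniq _ (isSaturated_cons.2 ⟨hxa, hc⟩) hn).1 hinc
  subst hc0
  cases c with
  | nil => exact absurd (isSaturated_nil.1 hc) hay.ne
  | cons z c =>
    obtain ⟨hn, hlex⟩ := huniq (b :: e :: c')
      (isSaturated_cons.2 ⟨hxb, isSaturated_cons.2 ⟨hbe, hc'⟩⟩) (by simp [hne])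
    simp only [labelWord, List.isChain_cons_cons] at hinc hn hlex hinc'
    obtain hlt | ⟨heq, hlex⟩ := List.cons_lex_cons_iff.1 hlex
    · exact hlt
    -- If the first labels tie, the second label along `b` is at least the one along `a`. Then `b`
    -- followed by the increasing chain of `[b, y]` is a second increasing chain, against
    -- uniqueness.
    · have hze : lab (r ++ [a]) z < lab (r ++ [b]) e ∨ lab (r ++ [a]) z = lab (r ++ [b]) e :=
        (List.cons_lex_cons_iff.1 hlex).imp_right And.left
      have hbe' : lab r b < lab (r ++ [b]) e := by
        rw [← heq]
        exact hze.elim hinc.1.trans fun h => h ▸ hinc.1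
      exact absurd ⟨hbe', hinc'⟩ hn

/-- Let `a` have maximal label in a set `I` of atoms of `[x, T]` that is closed downwards with
respect to labels. Every `y` above `a` and another atom in `I` is above a cover of `a` that is
itself above another atom in `I`. -/
theorem IsCLLabeling.exists_cover (hl : IsCLLabeling lab) (hr : IsSaturated ⊥ r x)
    {I : Set P} {T a' : P} (hcov : ∀ c ∈ I, x ⋖ c)
    (hI : ∀ c ∈ I, ∀ c', x ⋖ c' → c' ≤ T → lab r c' < lab r c → c' ∈ I)
    (ha : a ∈ I) (hmax : ∀ c ∈ I, ¬ lab r a < lab r c) (ha' : a' ∈ I) (hne : a' ≠ a)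
    (hyT : y ≤ T) (hay : a ≤ y) (hay' : a' ≤ y) :
    ∃ z, a ⋖ z ∧ z ≤ y ∧ ∃ c ∈ I, c ≠ a ∧ c ≤ z := by
  have hxa := hcov a ha
  have hay1 : a < y := hay.lt_of_ne fun h =>
    hne ((hxa.eq_or_eq (hcov a' ha').le (hay'.trans h.ge)).resolve_left (hcov a' ha').ne')
  obtain ⟨z, hz⟩ := hl.exists_isFirst (hr.snoc hxa) hay1
  -- An ascent here would make `a` the first atom of the increasing chain to `y`, so its label would
  -- lie below that of `a'`, against maximality.
  have hnlt : ¬ lab r a < lab (r ++ [a]) z := fun h =>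
    hmax a' ha' (hl.lab_lt hr (hz.cons hxa h) (hcov a' ha') hay' hne)
  obtain ⟨c, hc⟩ := hl.exists_isFirst hr (hxa.lt.trans hz.1.lt)
  have hca : c ≠ a := by
    rintro rfl
    obtain ⟨w, hw, hlt⟩ := hc.tail hz.1.lt
    obtain rfl := (hz.1.eq_or_eq hw.1.le hw.le).resolve_left hw.1.ne'
    exact hnlt hlt
  exact ⟨z, hz.1, hz.le, c, hI a ha c hc.1 ((hc.le.trans hz.le).trans hyT)
    (hl.lab_lt hr hc hxa hz.1.le hca.symm), hca, hc.le⟩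

/-- In the setting of `IsCLLabeling.exists_cover`, the covers of `a` that are above another atom
in `I` are closed downwards with respect to labels. -/
theorem IsCLLabeling.exists_le_of_lab_lt (hl : IsCLLabeling lab) (hr : IsSaturated ⊥ r x)
    {I : Set P} {T a' z' : P} (hcov : ∀ c ∈ I, x ⋖ c)
    (hI : ∀ c ∈ I, ∀ c', x ⋖ c' → c' ≤ T → lab r c' < lab r c → c' ∈ I)
    (ha : a ∈ I) (hmax : ∀ c ∈ I, ¬ lab r a < lab r c) (ha' : a' ∈ I) (hne : a' ≠ a)
    (haz : a ⋖ z) (ha'z : a' ≤ z) (haz' : a ⋖ z') (hz'T : z' ≤ T)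
    (hlt : lab (r ++ [a]) z' < lab (r ++ [a]) z) :
    ∃ c ∈ I, c ≠ a ∧ c ≤ z' := by
  have hxa := hcov a ha
  obtain ⟨c, hc⟩ := hl.exists_isFirst hr (hxa.lt.trans haz'.lt)
  by_cases hca : c = a
  -- If the chain through `a` to `z'` ascends, so does the one to `z`, whose second label is even
  -- larger. Then `a` is first in `[x, z]` and its label lies below that of `a'`.
  · subst hca
    obtain ⟨w, hw, hw'⟩ := hc.tail haz'.lt
    obtain rfl := (haz'.eq_or_eq hw.1.le hw.le).resolve_left hw.1.ne'
    exact absurd (hl.lab_lt hr ((isFirst_self haz).cons hxa (hw'.trans hlt)) (hcov a' ha') ha'z hne)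
      (hmax a' ha')
  · exact ⟨c, hI a ha c hc.1 (hc.le.trans hz'T)
      (hl.lab_lt hr hc hxa haz'.le (Ne.symm hca)), hca, hc.le⟩

end

end CL

end SubspaceArrangement
namespace SubspaceArrangement

/-! ### Signs of sums over upper sets generated by atoms. -/

section Sign

variable {P Λ : Type*} [PartialOrder P] [BoundedOrder P] [PartialOrder Λ]
  {lab : List P → P → Λ}

open Classical in
/-- A sum over the upper set generated by label-closed atoms of `[x, T]` has the sign `ε x`. -/
theorem IsCLLabeling.sign_sum_nonneg [Fintype P] (hl : IsCLLabeling lab) {T : P} {B : P → Prop}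
    {h ε : P → ℤ} (hT : h T = 1) (h0 : ∀ y, ¬ B y → y ≠ T → h y = 0)
    (hB : ∀ x y, x ≤ y → B y → B x)
    (hsum : ∀ x, B x → ∑ y with x ≤ y, h y = 0)
    (hε : ∀ x a, x ⋖ a → B a → ε a = - ε x)
    (hfirst : ∀ x r a, B x → IsSaturated ⊥ r x → IsFirst lab r x a T → ¬ B a → ε x = 1)
    (hBT : ∀ x, B x → x ≤ T)
    (x : P) (hx : B x) (r : List P) (hr : IsSaturated ⊥ r x) (I : Finset P)
    (hcov : ∀ c ∈ I, x ⋖ c ∧ c ≤ T)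
    (hI : ∀ c ∈ I, ∀ c', x ⋖ c' → c' ≤ T → lab r c' < lab r c → c' ∈ I) :
    -- The hypotheses determine `h`: on `B` it is the Möbius value `μ(y, T)` of the poset `B ∪ {T}`.
    -- Atoms of `[x, T]` outside `B` still take part, although `h` vanishes on them unless they
    -- equal `T`.
    0 ≤ ε x * ∑ y with ∃ c ∈ I, c ≤ y, h y := by
  induction x using (wellFounded_gt (α := P)).induction generalizing r I with
  | _ x ihx =>
  induction hn : I.card generalizing I with
  | zero =>
    obtain rfl := Finset.card_eq_zero.1 hn
    simp
  | succ n ihn =>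
  have hne : I.Nonempty := Finset.card_pos.1 (by omega)
  obtain ⟨a, ha⟩ := I.exists_maximalFor (lab r) hne
  have hmax : ∀ c ∈ I, ¬ lab r a < lab r c := fun c hc hlt => hlt.not_ge (ha.2 hc hlt.le)
  replace ha : a ∈ I := ha.1
  obtain ⟨hxa, haT⟩ := hcov a ha
  have hcov' : ∀ c ∈ (I : Set P), x ⋖ c := fun c hc => (hcov c hc).1
  have ih := ihn (I.erase a) (fun c hc => hcov c (Finset.mem_of_mem_erase hc))
    (fun c hc c' hxc' hc'T hlt => Finset.mem_erase.2
      ⟨fun h => hmax c (Finset.mem_of_mem_erase hc) (h ▸ hlt),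
        hI c (Finset.mem_of_mem_erase hc) c' hxc' hc'T hlt⟩)
    (by rw [Finset.card_erase_of_mem ha]; omega)
  let J : Finset P := {z | a ⋖ z ∧ z ≤ T ∧ ∃ c ∈ I, c ≠ a ∧ c ≤ z}
  -- Inclusion-exclusion: within `[x, T]`, the overlap of the upper sets of `a` and of the other
  -- atoms is the upper set of `J`. Elements not below `T` do not matter, since `h` vanishes there.
  have hsplit : ∑ y with ∃ c ∈ I, c ≤ y, h y = ∑ y with ∃ c ∈ I.erase a, c ≤ y, h y +
      (∑ y with a ≤ y, h y - ∑ y with ∃ c ∈ J, c ≤ y, h y) := by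
    simp only [Finset.sum_filter]
    rw [← Finset.sum_sub_distrib, ← Finset.sum_add_distrib]
    refine Finset.sum_congr rfl fun y _ => ?_
    by_cases hyT : y ≤ T
    · have h1 : (∃ c ∈ I, c ≤ y) ↔ (∃ c ∈ I.erase a, c ≤ y) ∨ a ≤ y := by
        constructor
        · rintro ⟨c, hc, hcy⟩
          by_cases hca : c = a
          · exact Or.inr (hca ▸ hcy)
          · exact Or.inl ⟨c, Finset.mem_erase.2 ⟨hca, hc⟩, hcy⟩
        · rintro (⟨c, hc, hcy⟩ | hay)
          · exact ⟨c, Finset.mem_of_mem_erase hc, hcy⟩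
          · exact ⟨a, ha, hay⟩
      have h2 : (∃ c ∈ J, c ≤ y) ↔ (∃ c ∈ I.erase a, c ≤ y) ∧ a ≤ y := by
        constructor
        · rintro ⟨z, hz, hzy⟩
          obtain ⟨haz, -, c, hc, hca, hcz⟩ := (Finset.mem_filter.1 hz).2
          exact ⟨⟨c, Finset.mem_erase.2 ⟨hca, hc⟩, hcz.trans hzy⟩, haz.le.trans hzy⟩
        · rintro ⟨⟨c, hc, hcy⟩, hay⟩
          obtain ⟨hca, hc⟩ := Finset.mem_erase.1 hc
          obtain ⟨z, haz, hzy, hz⟩ :=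
            hl.exists_cover hr hcov' hI ha hmax hc hca hyT hay hcy
          exact ⟨z, by simpa [J] using ⟨haz, hzy.trans hyT, hz⟩, hzy⟩
      rw [if_congr h1 rfl rfl, if_congr h2 rfl rfl]
      by_cases p : ∃ c ∈ I.erase a, c ≤ y <;> by_cases q : a ≤ y <;> simp only [p, q] <;> simp
    · rw [h0 y (fun hy => hyT (hBT y hy)) (fun hy => hyT hy.le)]
      simp
  have hJ : ∀ c ∈ J, a ⋖ c ∧ c ≤ T := fun c hc =>
    ⟨(Finset.mem_filter.1 hc).2.1, (Finset.mem_filter.1 hc).2.2.1⟩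
  by_cases haB : B a
  · have := ihx a hxa.lt haB (r ++ [a]) (hr.snoc hxa) J hJ
      (fun z hz z' haz' hz'T hlt => by
        obtain ⟨haz, -, c, hc, hca, hcz⟩ := (Finset.mem_filter.1 hz).2
        have := hl.exists_le_of_lab_lt hr hcov' hI ha hmax hc hca haz hcz haz' hz'T hlt
        simpa [J] using ⟨haz', hz'T, this⟩)
    rw [hε x a hxa haB] at this
    rw [hsplit, hsum a haB]
    linarith
  -- Above an atom outside `B` only `T` carries weight, so each upper set involved has sum `1` or
  -- `0`.
  · have hsing : ∀ y, a ≤ y → h y = if y = T then 1 else 0 := fun y hay => by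
      split_ifs with hyT
      · rw [hyT, hT]
      · exact h0 y (fun hy => haB (hB a y hay hy)) hyT
    have hsa : ∑ y with a ≤ y, h y = 1 := by
      rw [Finset.sum_congr rfl fun y hy => hsing y (Finset.mem_filter.1 hy).2]
      simp [haT]
    by_cases hI' : (I.erase a).Nonempty
    · obtain ⟨c, hc⟩ := hI'
      obtain ⟨hca, hc⟩ := Finset.mem_erase.1 hc
      obtain ⟨z, haz, hzT, hz⟩ :=
        hl.exists_cover hr hcov' hI ha hmax hc hca le_rfl haT (hcov c hc).2
      have hsJ : ∑ y with ∃ c ∈ J, c ≤ y, h y = 1 := by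
        rw [Finset.sum_congr rfl fun y hy => hsing y (by
          obtain ⟨c, hc, hcy⟩ := (Finset.mem_filter.1 hy).2
          exact (hJ c hc).1.le.trans hcy)]
        have : ∃ c ∈ J, c ≤ T := ⟨z, by simpa [J] using ⟨haz, hzT, hz⟩, hzT⟩
        simp [this]
      rw [hsplit, hsa, hsJ]
      simpa using ih
    -- Now `I = {a}`. The first atom of the increasing chain to `T` lies in `I` by label-closedness,
    -- hence is `a`, and `hfirst` gives the sign.
    · rw [Finset.not_nonempty_iff_eq_empty] at hI'
      have hJe : J = ∅ := Finset.eq_empty_of_forall_notMem fun z hz => by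
        obtain ⟨-, -, c, hc, hca, -⟩ := (Finset.mem_filter.1 hz).2
        exact Finset.notMem_empty c (hI' ▸ Finset.mem_erase.2 ⟨hca, hc⟩)
      obtain ⟨b, hb⟩ := hl.exists_isFirst hr (hxa.lt.trans_le haT)
      have hba : b = a := by
        by_contra hne
        exact Finset.notMem_empty b (hI' ▸ Finset.mem_erase.2
          ⟨hne, hI a ha b hb.1 hb.le (hl.lab_lt hr hb hxa haT (Ne.symm hne))⟩)
      rw [hsplit, hsa, hI', hJe, hfirst x r b hx hr hb (hba ▸ haB)]
      simp

open Classical in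
/-- The sign of the value at `⊥`, under the assumptions of `IsCLLabeling.sign_sum_nonneg`. -/
theorem IsCLLabeling.sign_bot_nonpos [Fintype P] (hl : IsCLLabeling lab) {T : P} {B : P → Prop}
    {h ε : P → ℤ} (hT : h T = 1) (h0 : ∀ y, ¬ B y → y ≠ T → h y = 0)
    (hB : ∀ x y, x ≤ y → B y → B x)
    (hsum : ∀ x, B x → ∑ y with x ≤ y, h y = 0)
    (hε : ∀ x a, x ⋖ a → B a → ε a = - ε x)
    (hfirst : ∀ x r a, B x → IsSaturated ⊥ r x → IsFirst lab r x a T → ¬ B a → ε x = 1)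
    (hBT : ∀ x, B x → x ≤ T) (hbot : B ⊥) : ε ⊥ * h ⊥ ≤ 0 := by
  let I : Finset P := {a | ⊥ ⋖ a ∧ a ≤ T}
  have hI : ∀ a, a ∈ I ↔ ⊥ ⋖ a ∧ a ≤ T := fun a => by
    simp only [I, Finset.mem_filter, Finset.mem_univ, true_and]
  have key := hl.sign_sum_nonneg hT h0 hB hsum hε hfirst hBT ⊥ hbot []
    (isSaturated_nil.2 rfl) I (fun c hc => (hI c).1 hc) (fun c _ c' h1 h2 _ => (hI c').2 ⟨h1, h2⟩)
  -- The upper set of all atoms below `T` contains everything but `⊥` on which `h` is nonzero.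
  have hs : ∑ y with ∃ c ∈ I, c ≤ y, h y + h ⊥ = 0 := by
    have h1 : h ⊥ = ∑ y, if y = ⊥ then h y else 0 := by simp
    rw [← hsum ⊥ hbot, h1, Finset.sum_filter, Finset.sum_filter, ← Finset.sum_add_distrib]
    refine Finset.sum_congr rfl fun y _ => ?_
    rw [if_pos (bot_le : ⊥ ≤ y)]
    by_cases hy : y = ⊥
    · rw [if_pos hy, if_neg, zero_add]
      rintro ⟨c, hc, hcy⟩
      exact ((hI c).1 hc).1.lt.not_ge (hcy.trans hy.le)
    · rw [if_neg hy, add_zero]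
      refine ite_eq_left_iff.2 fun hny => ?_
      by_contra hne
      have hyT : y ≤ T := by
        by_contra hyT
        exact hne (h0 y (fun hy => hyT (hBT y hy)) (fun hy => hyT hy.le)).symm
      obtain ⟨c, hc⟩ := hl.exists_isFirst (isSaturated_nil.2 rfl) (bot_lt_iff_ne_bot.2 hy)
      exact hny ⟨c, (hI c).2 ⟨hc.1, hc.le.trans hyT⟩, hc.le⟩
  rw [eq_neg_of_add_eq_zero_left hs] at key
  linarith

end Sign

end SubspaceArrangement
namespace SubspaceArrangement

/-! ### Mod-2-purity and the parity of the dimension. -/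

section Parity

variable {L : Type*} [PartialOrder L]

/-- `D` is a maximal chain among the elements above `y`, with least element `y`. -/
def IsUpperMaxChain (y : L) (D : Set L) : Prop :=
  y ∈ D ∧ (∀ w ∈ D, y ≤ w) ∧ IsChain (· ≤ ·) D ∧
    ∀ w, y ≤ w → (∀ v ∈ D, w ≤ v ∨ v ≤ w) → w ∈ D

theorem IsUpperMaxChain.insert {y z : L} {D : Set L} (hD : IsUpperMaxChain z D) (hyz : y ⋖ z) :
    IsUpperMaxChain y (insert y D) := by
  obtain ⟨hz, hle, hch, hmax⟩ := hD
  refine ⟨Set.mem_insert _ _, ?_, ?_, ?_⟩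
  · rintro w (rfl | hw)
    · exact le_rfl
    · exact hyz.le.trans (hle w hw)
  · exact hch.insert fun w hw _ => Or.inl (hyz.le.trans (hle w hw))
  · intro w hyw hcomp
    rcases hcomp z (Set.mem_insert_of_mem _ hz) with hwz | hzw
    · rcases hyz.eq_or_eq hyw hwz with rfl | rfl
      · exact Set.mem_insert _ _
      · exact Set.mem_insert_of_mem _ hz
    · exact Set.mem_insert_of_mem _
        (hmax w hzw fun v hv => hcomp v (Set.mem_insert_of_mem _ hv))

theorem IsUpperMaxChain.notMem {y z : L} {D : Set L} (hD : IsUpperMaxChain z D) (hyz : y < z) :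
    y ∉ D := fun h => (hD.2.1 y h).not_gt hyz

variable [Finite L]

/-- The part below `y` of one maximal chain through `y` extends both `D` and `D'` to maximal chains
of `L`, whose lengths have the same parity. -/
theorem IsModTwoPure.ncard_mod_two (hL : IsModTwoPure L) {y : L} {D D' : Set L}
    (hD : IsUpperMaxChain y D) (hD' : IsUpperMaxChain y D') : D.ncard % 2 = D'.ncard % 2 := by
  obtain ⟨M, hM, hyM⟩ := (Set.subsingleton_singleton (a := y)).isChain.exists_maxChain (r := (· ≤ ·))
  rw [Set.singleton_subset_iff] at hyM
  have key : ∀ D : Set L, IsUpperMaxChain y D →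
      IsMaxChain (· ≤ ·) ({w | w ∈ M ∧ w < y} ∪ D) ∧
        ({w | w ∈ M ∧ w < y} ∪ D).ncard = {w | w ∈ M ∧ w < y}.ncard + D.ncard ∧
        0 < D.ncard := by
    rintro D ⟨hy, hle, hch, hmax⟩
    refine ⟨⟨?_, ?_⟩, ?_, ?_⟩
    · rintro a (ha | ha) b (hb | hb) hab
      · exact hM.1 ha.1 hb.1 hab
      · exact Or.inl (ha.2.le.trans (hle b hb))
      · exact Or.inr (hb.2.le.trans (hle a ha))
      · exact hch ha hb hab
    · intro t ht hsub
      refine hsub.antisymm fun w hw => ?_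
      have hcomp : ∀ v ∈ {w | w ∈ M ∧ w < y} ∪ D, w ≤ v ∨ v ≤ w := fun v hv =>
        ht.total hw (hsub hv)
      rcases hcomp y (Or.inr hy) with h | h
      · rcases h.eq_or_lt with rfl | h
        · exact Or.inr hy
        · refine Or.inl ⟨?_, h⟩
          have hins : IsChain (· ≤ ·) (insert w M) := hM.1.insert fun v hv _ => by
            rcases hM.1.total hv hyM with hvy | hyv
            · rcases hvy.eq_or_lt with rfl | hvy
              · exact Or.inl h.le
              · exact hcomp v (Or.inl ⟨hv, hvy⟩)
            · exact Or.inl (h.le.trans hyv)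
          rw [hM.2 hins (Set.subset_insert _ _)]
          exact Set.mem_insert _ _
      · exact Or.inr (hmax w h fun v hv => hcomp v (Or.inr hv))
    · refine Set.ncard_union_eq ?_ (Set.toFinite _) (Set.toFinite _)
      exact Set.disjoint_left.2 fun w hw hwD => hw.2.not_ge (hle w hwD)
    · exact (Set.ncard_pos (Set.toFinite _)).2 ⟨y, hy⟩
  obtain ⟨h1, h2, h3⟩ := key D hD
  obtain ⟨h1', h2', h3'⟩ := key D' hD'
  rcases hL with hL | hL
  · have e := hL _ h1
    have e' := hL _ h1'
    rw [Nat.even_iff] at e e'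
    omega
  · have e := hL _ h1
    have e' := hL _ h1'
    rw [Nat.odd_iff] at e e'
    omega

variable {δ : L → ℕ}

/-- Heredity lets the chain descend one dimension at a time to dimension `0`; strict monotonicity
makes each such step a cover. -/
theorem exists_isUpperMaxChain (hδ : StrictAnti δ)
    (hher : ∀ x, 0 < δ x → ∃ y, x < y ∧ δ y + 1 = δ x) (y : L) :
    ∃ D, IsUpperMaxChain y D ∧ D.ncard = δ y + 1 := by
  induction hn : δ y generalizing y with
  | zero =>
    refine ⟨{y}, ⟨rfl, by simp, IsChain.singleton, fun w hyw _ => ?_⟩, by simp⟩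
    rcases hyw.eq_or_lt with rfl | h
    · rfl
    · exact absurd (hδ h) (by omega)
  | succ n ih =>
    obtain ⟨z, hyz, hz⟩ := hher y (by omega)
    obtain ⟨D, hD, hcard⟩ := ih z (by omega)
    have hcov : y ⋖ z := ⟨hyz, fun w h1 h2 => by
      have := hδ h1
      have := hδ h2
      omega⟩
    refine ⟨_, hD.insert hcov, ?_⟩
    rw [Set.ncard_insert_of_notMem (hD.notMem hyz) (Set.toFinite _), hcard]

/-- The dimension changes its parity along each cover. -/
theorem IsModTwoPure.dim_mod_two (hL : IsModTwoPure L) (hδ : StrictAnti δ)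
    (hher : ∀ x, 0 < δ x → ∃ y, x < y ∧ δ y + 1 = δ x) {y z : L} (hyz : y ⋖ z) :
    (δ z + 1) % 2 = δ y % 2 := by
  obtain ⟨D, hD, hDc⟩ := exists_isUpperMaxChain hδ hher y
  obtain ⟨D', hD', hDc'⟩ := exists_isUpperMaxChain hδ hher z
  have := hL.ncard_mod_two hD (hD'.insert hyz)
  rw [Set.ncard_insert_of_notMem (hD'.notMem hyz.lt) (Set.toFinite _)] at this
  omega

end Parity

/-! ### Increasing chains in hereditary posets. -/

section Hereditary

variable {L Λ : Type*} [PartialOrder L] [OrderBot L] [PartialOrder Λ]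
  {lab : List (WithTop L) → WithTop L → Λ} {δ : L → ℕ}

/-- The increasing chain from `x` to the greatest element starts with a step that lowers the
dimension by one. -/
theorem IsCLLabeling.dim_isFirst [Finite L] (hl : IsCLLabeling lab) (hδ : StrictAnti δ)
    (hher : ∀ x, 0 < δ x → ∃ y, x < y ∧ δ y + 1 = δ x) {x : L} (hx : 0 < δ x)
    {r : List (WithTop L)} (hr : IsSaturated ⊥ r (x : WithTop L)) {a : WithTop L}
    (ha : IsFirst lab r (x : WithTop L) a ⊤) : ∃ b : L, a = b ∧ δ b + 1 = δ x := by
  induction hn : δ x using Nat.strong_induction_on generalizing x r a with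
  | _ n ih =>
  subst hn
  have hcover : ∀ b : L, x < b → δ b + 1 = δ x → (x : WithTop L) ⋖ b := fun b hxb hb => by
    rw [WithTop.coe_covBy_coe]
    exact ⟨hxb, fun w h1 h2 => by
      have := hδ h1
      have := hδ h2
      omega⟩
  have hne : {b : L | x < b ∧ δ b + 1 = δ x}.Nonempty := hher x hx
  -- Among the elements one dimension below `x`, take `b` of minimal label. If `a` is not one of
  -- them, an atom of smaller label than `b` and of the same dimension will appear.
  obtain ⟨b, hb⟩ := (Set.toFinite {b : L | x < b ∧ δ b + 1 = δ x}).exists_minimalFor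
    (fun b : L => lab r b) _ hne
  obtain ⟨⟨hxb, hbδ⟩, hmin⟩ := hb
  by_contra hcon
  have hab : (b : WithTop L) ≠ a := fun h => hcon ⟨b, h.symm, hbδ⟩
  have hxb' := hcover b hxb hbδ
  have hlt := hl.lab_lt hr ha hxb' le_top hab
  have hrb := hr.snoc hxb'
  obtain ⟨z, hz⟩ := hl.exists_isFirst hrb (WithTop.coe_lt_top b)
  have hnlt : ¬ lab r b < lab (r ++ [(b : WithTop L)]) z := fun h =>
    hlt.not_gt (hl.lab_lt hr (hz.cons hxb' h) ha.1 le_top hab.symm)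
  rcases Nat.eq_zero_or_pos (δ b) with hb0 | hbpos
  · have haT : a ≠ ⊤ := by
      rintro rfl
      exact ha.1.2 hxb'.lt (WithTop.coe_lt_top b)
    obtain ⟨a', rfl⟩ := WithTop.ne_top_iff_exists.1 haT
    have := hδ (WithTop.coe_lt_coe.1 ha.1.lt)
    exact hcon ⟨a', rfl, by omega⟩
  · obtain ⟨z', rfl, hz'⟩ := ih (δ b) (by omega) hbpos hrb hz rfl
    -- By induction `z'` is two dimensions below `x`. The chain through `b` to `z'` is not
    -- increasing, so the increasing one passes through some `c ≠ b` strictly between, of the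
    -- dimension of `b` and of smaller label.
    obtain ⟨c, hc⟩ := hl.exists_isFirst hr (hxb'.lt.trans hz.1.lt)
    have hcb : c ≠ b := by
      rintro rfl
      obtain ⟨w, hw, hlt⟩ := hc.tail hz.1.lt
      obtain rfl := (hz.1.eq_or_eq hw.1.le hw.le).resolve_left hw.1.ne'
      exact hnlt hlt
    have hcz : c ≠ (z' : WithTop L) := by
      rintro rfl
      exact hc.1.2 hxb'.lt hz.1.lt
    have hclt := hl.lab_lt hr hc hxb' hz.1.le hcb.symm
    have hcT : c ≠ ⊤ := (hc.le.trans_lt (WithTop.coe_lt_top z')).ne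
    obtain ⟨c', rfl⟩ := WithTop.ne_top_iff_exists.1 hcT
    have h1 := hδ (WithTop.coe_lt_coe.1 hc.1.lt)
    have h2 := hδ (WithTop.coe_lt_coe.1 (hc.le.lt_of_ne hcz))
    exact hclt.not_ge (hmin ⟨WithTop.coe_lt_coe.1 hc.1.lt, by omega⟩ hclt.le)

end Hereditary

/-! ### Sums of the Möbius function over lower sets. -/

section Mobius

variable {L Λ : Type*} [PartialOrder L] [OrderBot L] [Fintype L] [DecidableEq L]
  [LocallyFiniteOrder L] [PartialOrder Λ] {lab : List (WithTop L) → WithTop L → Λ}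

open Classical in
/-- The sum of the Möbius function over a lower set `B` has sign `-ε ⊥`. -/
theorem IsCLLabeling.sign_sum_mu (hl : IsCLLabeling lab) {T : WithTop L} {B : L → Prop}
    {ε : L → ℤ} (hB : ∀ x y, x ≤ y → B y → B x) (hBT : ∀ x : L, B x → (x : WithTop L) < T)
    (hε : ∀ x a, x ⋖ a → B a → ε a = - ε x)
    (hfirst : ∀ (x : L) r a, B x → IsSaturated ⊥ r (x : WithTop L) →
      IsFirst lab r (x : WithTop L) a T → (∀ b : L, a = b → ¬ B b) → ε x = 1)
    (hbot : B ⊥) : 0 ≤ ε ⊥ * ∑ y with B y, IncidenceAlgebra.mu ℤ ⊥ y := by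
  -- This is `μ(y, T)` in the poset `B` with `T` adjoined as top: the values `μ(y, z)` for `z` in
  -- `B` are unchanged, and the sum over the interval up to `T` must vanish.
  let g : L → ℤ := fun y => - ∑ z with B z ∧ y ≤ z, IncidenceAlgebra.mu ℤ y z
  have hg : ∀ x, B x → ∑ y with B y ∧ x ≤ y, g y = -1 := fun x hx => by
    simp only [g]
    rw [Finset.sum_neg_distrib, neg_inj]
    simp only [Finset.sum_filter]
    have : ∀ y, (if B y ∧ x ≤ y then
        ∑ z, if B z ∧ y ≤ z then IncidenceAlgebra.mu ℤ y z else 0 else 0) =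
        ∑ z, if B z then if y ∈ Finset.Icc x z then IncidenceAlgebra.mu ℤ y z else 0 else 0 := by
      intro y
      split_ifs with h
      · refine Finset.sum_congr rfl fun z _ => ?_
        by_cases hz : B z <;> simp [hz, h.2]
      · symm
        refine Finset.sum_eq_zero fun z _ => ?_
        split_ifs with hz hy
        · rw [Finset.mem_Icc] at hy
          exact absurd ⟨hB y z hy.2 hz, hy.1⟩ h
        all_goals rfl
    rw [Finset.sum_congr rfl fun y _ => this y, Finset.sum_comm]
    have : ∀ z, (∑ y, if B z then
        if y ∈ Finset.Icc x z then IncidenceAlgebra.mu ℤ y z else 0 else 0) =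
        if x = z then 1 else 0 := by
      intro z
      by_cases hz : B z
      · simp only [hz, if_true]
        rw [Finset.sum_ite_mem, Finset.univ_inter, IncidenceAlgebra.sum_Icc_mu_left]
      · simp only [hz, if_false, Finset.sum_const_zero]
        rw [if_neg]
        rintro rfl
        exact hz hx
    rw [Finset.sum_congr rfl fun z _ => this z]
    simp
  let B' : WithTop L → Prop := fun p => ∃ y : L, p = y ∧ B y
  have hB'c : ∀ y : L, B' y ↔ B y := fun y =>
    ⟨fun ⟨z, hz, hz'⟩ => by rwa [WithTop.coe_inj.1 hz], fun h => ⟨y, rfl, h⟩⟩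
  -- The default value in `untopD` is never relevant: `⊤` is not in `B'`.
  let h : WithTop L → ℤ := fun p => if B' p then g (p.untopD ⊥) else if p = T then 1 else 0
  have hTB : ¬ B' T := fun ⟨y, hy, hy'⟩ => (hBT y hy').ne hy.symm
  have key := hl.sign_bot_nonpos (T := T) (B := B') (h := h) (ε := fun p => ε (p.untopD ⊥))
    (by simp [h, hTB]) (fun y hy hyT => by simp [h, hy, hyT])
    (by
      rintro p _ hp ⟨y, rfl, hy⟩
      obtain ⟨x, rfl⟩ := WithTop.ne_top_iff_exists.1 (hp.trans_lt (WithTop.coe_lt_top y)).ne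
      exact ⟨x, rfl, hB x y (WithTop.coe_le_coe.1 hp) hy⟩)
    (by
      rintro _ ⟨x, rfl, hx⟩
      have h1 : ∀ p : WithTop L, (if (x : WithTop L) ≤ p then h p else 0) =
          (if B' p ∧ (x : WithTop L) ≤ p then g (p.untopD ⊥) else 0) + if p = T then 1 else 0 := by
        intro p
        by_cases hp : B' p
        · have : p ≠ T := fun e => hTB (e ▸ hp)
          simp [h, hp, this]
        · by_cases hpT : p = T
          · subst hpT
            simp [h, hp, (hBT x hx).le]
          · simp [h, hp, hpT]
      rw [Finset.sum_filter]
      refine Eq.trans (Finset.sum_congr rfl fun p _ => Eq.trans ?_ (h1 p)) ?_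
      · split_ifs <;> rfl
      rw [Finset.sum_add_distrib]
      have h2 : ∑ p : WithTop L, (if B' p ∧ (x : WithTop L) ≤ p then g (p.untopD ⊥) else 0) =
          ∑ y with B y ∧ x ≤ y, g y := by
        rw [Finset.sum_filter]
        have h3 : ¬ B' ⊤ := fun ⟨y, hy, _⟩ => WithTop.top_ne_coe hy
        have h4 : ∀ f : WithTop L → ℤ, ∑ p, f p = f ⊤ + ∑ y : L, f y := Fintype.sum_option
        rw [h4]
        simp [h3, hB'c]
      rw [h2, hg x hx]
      simp)
    (by
      rintro p _ hp ⟨a, rfl, ha⟩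
      obtain ⟨x, rfl⟩ := WithTop.ne_top_iff_exists.1 (hp.lt.trans (WithTop.coe_lt_top a)).ne
      simpa using hε x a (WithTop.coe_covBy_coe.1 hp) ha)
    (by
      rintro _ r a ⟨x, rfl, hx⟩ hr ha haB
      simpa using hfirst x r a hx hr ha (fun b hab hb => haB ⟨b, hab, hb⟩))
    (by
      rintro _ ⟨x, rfl, hx⟩
      exact (hBT x hx).le)
    ⟨⊥, rfl, hbot⟩
  have hbot' : h ⊥ = - ∑ y with B y, IncidenceAlgebra.mu ℤ ⊥ y := by
    have : B' ⊥ := ⟨⊥, rfl, hbot⟩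
    have h4 : (⊥ : WithTop L).untopD ⊥ = ⊥ := rfl
    simp [h, this, g, h4]
  rw [hbot'] at key
  have h4 : (⊥ : WithTop L).untopD ⊥ = ⊥ := rfl
  simp only [h4] at key
  linarith

end Mobius

end SubspaceArrangement
namespace SubspaceArrangement

/-! ### The two lower sets that give the coefficients. -/

section Hereditary

variable {L Λ : Type*} [PartialOrder L] [OrderBot L] [Fintype L] [DecidableEq L]
  [LocallyFiniteOrder L] [PartialOrder Λ] {lab : List (WithTop L) → WithTop L → Λ} {δ : L → ℕ}

/-- The sign of the Möbius function of a hereditary, mod-2-pure poset with a CL-labeling. -/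
theorem IsCLLabeling.sign_mu (hl : IsCLLabeling lab) (hL : IsModTwoPure L) (hδ : StrictAnti δ)
    (hher : ∀ x, 0 < δ x → ∃ y, x < y ∧ δ y + 1 = δ x) {x : L} (hx : x ≠ ⊥) :
    (-1) ^ (δ ⊥ + δ x + 1) * IncidenceAlgebra.mu ℤ ⊥ x ≤ 0 := by
  classical
  have hpar := fun y z => hL.dim_mod_two hδ hher (y := y) (z := z)
  have key := hl.sign_sum_mu (T := x) (B := fun y => y < x) (ε := fun y => (-1) ^ (δ y + δ x + 1))
    (fun y z hyz hz => hyz.trans_lt hz) (fun y hy => WithTop.coe_lt_coe.2 hy)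
    (fun y a hya _ => by
      have := hpar y a hya
      rw [← neg_one_mul ((-1 : ℤ) ^ _), ← pow_succ', neg_one_pow_eq_pow_mod_two,
        neg_one_pow_eq_pow_mod_two (_ + 1)]
      congr 1
      omega)
    (fun y r a _ _ ha hax => by
      obtain ⟨b, rfl⟩ := WithTop.ne_top_iff_exists.1 (ha.le.trans_lt (WithTop.coe_lt_top x)).ne
      -- A first step below `x` in the order stays in `B`, so leaving `B` means `x` covers `y`, and
      -- the parity of the dimension changes.
      obtain rfl := (WithTop.coe_le_coe.1 ha.le).eq_or_lt.resolve_right (hax b rfl)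
      have := hpar y b (WithTop.coe_covBy_coe.1 ha.1)
      rw [neg_one_pow_eq_pow_mod_two, show (δ y + δ b + 1) % 2 = 0 by omega, pow_zero])
    (bot_lt_iff_ne_bot.2 hx)
  have hsum : ∑ y with y < x, IncidenceAlgebra.mu ℤ ⊥ y = - IncidenceAlgebra.mu ℤ ⊥ x := by
    rw [IncidenceAlgebra.mu_eq_neg_sum_Ico_of_ne hx.symm, neg_neg]
    exact Finset.sum_congr (by ext; simp) fun _ _ => rfl
  rw [hsum] at key
  linarith

/-- The sign of the truncated sum of the Möbius function of a hereditary, mod-2-pure poset with a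
CL-labeling. -/
theorem IsCLLabeling.sign_sum_mu_dim (hl : IsCLLabeling lab) (hL : IsModTwoPure L)
    (hδ : StrictAnti δ) (hher : ∀ x, 0 < δ x → ∃ y, x < y ∧ δ y + 1 = δ x) {j : ℕ}
    (hj : j ≤ δ ⊥) :
    0 ≤ (-1) ^ (δ ⊥ + j) * ∑ y with j ≤ δ y, IncidenceAlgebra.mu ℤ ⊥ y := by
  classical
  have hpar := fun y z => hL.dim_mod_two hδ hher (y := y) (z := z)
  have key := hl.sign_sum_mu (T := ⊤) (B := fun y => j ≤ δ y) (ε := fun y => (-1) ^ (δ y + j))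
    (fun y z hyz hz => hz.trans (hδ.antitone hyz)) (fun y _ => WithTop.coe_lt_top y)
    (fun y a hya _ => by
      have := hpar y a hya
      rw [← neg_one_mul ((-1 : ℤ) ^ _), ← pow_succ', neg_one_pow_eq_pow_mod_two,
        neg_one_pow_eq_pow_mod_two (_ + 1)]
      congr 1
      omega)
    (fun y r a hy hr ha hab => by
      rcases hy.eq_or_lt with rfl | hlt
      · rw [neg_one_pow_eq_pow_mod_two, show (δ y + δ y) % 2 = 0 by omega, pow_zero]
      · obtain ⟨b, rfl, hb⟩ := hl.dim_isFirst hδ hher (by omega) hr ha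
        exact absurd (show j ≤ δ b by omega) (hab b rfl))
    hj
  convert key

end Hereditary

/-! ### Intersection semilattices and the truncated dimension. -/

section Arrangement

variable {X : Type*} [CompleteLattice X] {dim : X → ℕ} {A : Finset X} {d : ℕ}

theorem IsDimensional.lt_dim_top (hd : IsDimensional dim A d) (hA : ⊤ ∉ A)
    (hdim : ∀ x y : X, x ≠ ⊥ → x < y → dim x < dim y) : d < dim ⊤ := by
  obtain ⟨K, hK, hK0, rfl⟩ := hd.1
  exact hdim _ _ hK0 (lt_top_iff_ne_top.2 fun h => hA (h ▸ hK))

variable [Nontrivial X]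

theorem IntersectionSemilattice.ne_bot_iff {x : IntersectionSemilattice A} :
    x ≠ ⊥ ↔ x.1 ≠ ⊤ :=
  not_congr ⟨fun h => h ▸ rfl, fun h => Subtype.ext h⟩

theorem IsDimensional.dim_le (hd : IsDimensional dim A d)
    (hdim : ∀ x y : X, x ≠ ⊥ → x < y → dim x < dim y) {x : IntersectionSemilattice A}
    (hx : x ≠ ⊥) : dim x.1 ≤ d := by
  obtain ⟨x, hx0, B, hBA, rfl⟩ := x
  obtain rfl | ⟨K, hK⟩ := B.eq_empty_or_nonempty
  · exact absurd sInf_empty (IntersectionSemilattice.ne_bot_iff.1 hx)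
  · have hle : sInf B ≤ K := sInf_le hK
    have hK0 : K ≠ ⊥ := fun h => hx0 (le_bot_iff.1 (h ▸ hle))
    have hKd := hd.2 K (hBA hK) hK0
    rcases hle.eq_or_lt with h | h
    · exact (congrArg dim h).le.trans hKd
    · exact (hdim _ _ hx0 h).le.trans hKd

variable (dim A d) in
/-- The dimension, except that the least element gets the dimension `d + 1`. -/
noncomputable def truncatedDim (x : IntersectionSemilattice A) : ℕ :=
  if x = ⊥ then d + 1 else dim x.1

theorem truncatedDim_bot : truncatedDim dim A d ⊥ = d + 1 := if_pos rfl

theorem truncatedDim_of_ne {x : IntersectionSemilattice A} (hx : x ≠ ⊥) :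
    truncatedDim dim A d x = dim x.1 := if_neg hx

theorem IsDimensional.strictAnti_truncatedDim (hd : IsDimensional dim A d)
    (hdim : ∀ x y : X, x ≠ ⊥ → x < y → dim x < dim y) : StrictAnti (truncatedDim dim A d) := by
  intro x y hxy
  have hy : y ≠ ⊥ := (bot_le.trans_lt hxy).ne'
  rw [truncatedDim_of_ne hy]
  by_cases hx : x = ⊥
  · rw [hx, truncatedDim_bot]
    exact Nat.lt_succ_of_le (hd.dim_le hdim hy)
  · rw [truncatedDim_of_ne hx]
    exact hdim y.1 x.1 y.2.1 (show y.1 < x.1 from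
      lt_of_le_of_ne hxy.le fun h => hxy.ne' (Subtype.ext h))

/-- Heredity says nothing about `0̂`, and members may have codimension above one. Giving `0̂` the
value `d + 1` lets a `d`-dimensional member serve as the element one step below in dimension. -/
theorem IsDimensional.exists_truncatedDim (hd : IsDimensional dim A d) (hA : ⊤ ∉ A)
    (hh : IsHereditary dim A) (x : IntersectionSemilattice A) (hx : 0 < truncatedDim dim A d x) :
    ∃ y, x < y ∧ truncatedDim dim A d y + 1 = truncatedDim dim A d x := by
  by_cases hx0 : x = ⊥
  · obtain ⟨K, hK, hK0, rfl⟩ := hd.1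
    let y : IntersectionSemilattice A := ⟨K, hK0, {K}, by simpa using hK, sInf_singleton⟩
    have hy : y ≠ ⊥ := IntersectionSemilattice.ne_bot_iff.2 fun h => hA (h ▸ hK)
    refine ⟨y, hx0 ▸ bot_lt_iff_ne_bot.2 hy, ?_⟩
    rw [hx0, truncatedDim_of_ne hy, truncatedDim_bot]
  · rw [truncatedDim_of_ne hx0] at hx ⊢
    obtain ⟨y, hxy, hy⟩ := hh x hx0 hx
    exact ⟨y, hxy, by rwa [truncatedDim_of_ne (bot_le.trans_lt hxy).ne']⟩

theorem IsDimensional.sign_mobius (hd : IsDimensional dim A d) (hA : ⊤ ∉ A)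
    (hdim : ∀ x y : X, x ≠ ⊥ → x < y → dim x < dim y) (hh : IsHereditary dim A)
    (hp : IsModTwoPure (IntersectionSemilattice A)) (hs : IsCLShellableArrangement A)
    {x : IntersectionSemilattice A} (hx : x ≠ ⊥) :
    (-1) ^ (d - dim x.1) * mobius A x ≤ 0 := by
  obtain ⟨Λ, _, lab, hl⟩ := hs
  have key := hl.sign_mu hp (hd.strictAnti_truncatedDim hdim) (hd.exists_truncatedDim hA hh) hx
  rw [truncatedDim_bot, truncatedDim_of_ne hx] at key
  have hle := hd.dim_le hdim hx
  rwa [neg_one_pow_eq_pow_mod_two, show (d + 1 + dim x.1 + 1) % 2 = (d - dim x.1) % 2 by omega,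
    ← neg_one_pow_eq_pow_mod_two] at key

theorem IsDimensional.sign_sum_mobius (hd : IsDimensional dim A d) (hA : ⊤ ∉ A)
    (hdim : ∀ x y : X, x ≠ ⊥ → x < y → dim x < dim y) (hh : IsHereditary dim A)
    (hp : IsModTwoPure (IntersectionSemilattice A)) (hs : IsCLShellableArrangement A)
    {j : ℕ} (hj : j ≤ d) :
    (-1) ^ (d - j) * ∑ x : IntersectionSemilattice A with j ≤ dim x.1, mobius A x ≤ 0 := by
  obtain ⟨Λ, _, lab, hl⟩ := hs
  have key := hl.sign_sum_mu_dim hp (hd.strictAnti_truncatedDim hdim)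
    (hd.exists_truncatedDim hA hh) (j := j) (by rw [truncatedDim_bot]; omega)
  rw [truncatedDim_bot, neg_one_pow_eq_pow_mod_two,
    show (d + 1 + j) % 2 = (d - j + 1) % 2 by omega, ← neg_one_pow_eq_pow_mod_two, pow_succ] at key
  -- Truncation does not affect the condition for `j ≤ d`: both `d + 1` and `dim ⊤ > d` exceed `j`.
  have hfilter : ∀ x : IntersectionSemilattice A, j ≤ truncatedDim dim A d x ↔ j ≤ dim x.1 := by
    intro x
    by_cases hx : x = ⊥
    · have h1 := hd.lt_dim_top hA hdim
      have h2 : dim x.1 = dim ⊤ := by rw [hx]; rfl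
      rw [h2, hx, truncatedDim_bot]
      exact ⟨fun _ => by omega, fun _ => by omega⟩
    · rw [truncatedDim_of_ne hx]
  rw [Finset.filter_congr fun x _ => hfilter x] at key
  unfold mobius
  linarith

end Arrangement

/-! ### Dimensions and coefficients over a field. -/

section Field

variable {F : Type*} [Field F] {n : ℕ}

theorem affineDim_lt {K K' : AffineSubspace F (Fin n → F)} (hK : K ≠ ⊥) (h : K < K') :
    affineDim K < affineDim K' :=
  Submodule.finrank_lt_finrank_of_lt
    (AffineSubspace.direction_lt_of_nonempty h ((AffineSubspace.nonempty_iff_ne_bot K).2 hK))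

theorem affineDim_top : affineDim (⊤ : AffineSubspace F (Fin n → F)) = n := by
  rw [affineDim, AffineSubspace.direction_top, finrank_top, Module.finrank_fin_fun]

theorem projDim_lt {K K' : Projectivization.Subspace F (Fin n → F)} (hK : K ≠ ⊥) (h : K < K') :
    projDim K < projDim K' := by
  have h1 : Projectivization.Subspace.submodule K ≠ ⊥ := fun e => hK
    (Projectivization.Subspace.submodule.injective (e.trans (map_bot _).symm))
  have h2 := Submodule.finrank_lt_finrank_of_lt (Projectivization.Subspace.submodule.strictMono h)
  -- The smaller submodule has positive rank, so the truncated subtraction in `projDim` keeps the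
  -- inequality strict.
  have h3 := Submodule.one_le_finrank_iff.2 h1
  unfold projDim
  omega

theorem projDim_top : projDim (⊤ : Projectivization.Subspace F (Fin n → F)) = n - 1 := by
  rw [projDim, map_top, finrank_top, Module.finrank_fin_fun]

theorem coeff_charPoly (A : Finset (AffineSubspace F (Fin n → F))) (j : ℕ) :
    (charPoly A).coeff j = ∑ x : IntersectionSemilattice A with affineDim x.1 = j, mobius A x := by
  simp [charPoly, Polynomial.coeff_X_pow, Finset.sum_filter, eq_comm]

theorem coeff_reducedCharPoly [NeZero n] (A : Finset (Projectivization.Subspace F (Fin n → F)))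
    (j : ℕ) : (reducedCharPoly A).coeff j =
      ∑ x : IntersectionSemilattice A with j ≤ projDim x.1, mobius A x := by
  simp [reducedCharPoly, Polynomial.coeff_X_pow, Finset.sum_filter]

end Field

section Sum

variable {X : Type*} [CompleteLattice X] [Nontrivial X] {A : Finset X}

/-- A sum of Möbius values over elements whose only possible member is the least one. -/
theorem sum_mobius_eq_ite {p : IntersectionSemilattice A → Prop} [DecidablePred p]
    (hp : ∀ x, x ≠ ⊥ → ¬ p x) : ∑ x with p x, mobius A x = if p ⊥ then 1 else 0 := by
  rw [Finset.sum_filter, Finset.sum_eq_single ⊥ (fun x _ hx => if_neg (hp x hx)) (by simp)]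
  simp [mobius]

end Sum

end SubspaceArrangement

/-! ### The main theorem. -/

open SubspaceArrangement in
theorem theoremH {F : Type*} [Field F] (n d : ℕ) :
    (∀ A : Finset (AffineSubspace F (Fin n → F)),
      ⊤ ∉ A → IsDimensional affineDim A d →
      IsHereditary affineDim A → IsModTwoPure (IntersectionSemilattice A) →
      IsCLShellableArrangement A →
        charPoly A = ∑ j ∈ Finset.range (d + 1), C ((charPoly A).coeff j) * X ^ j + X ^ n ∧
        ∀ j ≤ d, (-1) ^ (d - j) * (charPoly A).coeff j ≤ 0) ∧
    (∀ [NeZero n] (A : Finset (Projectivization.Subspace F (Fin n → F))),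
      ⊤ ∉ A → IsDimensional projDim A d →
      IsHereditary projDim A → IsModTwoPure (IntersectionSemilattice A) →
      IsCLShellableArrangement A →
        reducedCharPoly A =
          ∑ j ∈ Finset.range (d + 1), C ((reducedCharPoly A).coeff j) * X ^ j +
            ∑ j ∈ Finset.Icc (d + 1) (n - 1), X ^ j ∧
        ∀ j ≤ d, (-1) ^ (d - j) * (reducedCharPoly A).coeff j ≤ 0) := by
  constructor
  · intro A hA hd hh hp hs
    have hdim := fun (K K' : AffineSubspace F (Fin n → F)) => affineDim_lt (K := K) (K' := K')
    have hdn := hd.lt_dim_top hA hdim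
    have hbot : affineDim (⊥ : IntersectionSemilattice A).1 = n := affineDim_top
    rw [affineDim_top] at hdn
    constructor
    · ext j
      simp only [coeff_add, finsetSum_coeff, coeff_C_mul, coeff_X_pow, mul_ite, mul_one, mul_zero,
        Finset.sum_ite_eq, Finset.mem_range]
      by_cases hj : j < d + 1
      · rw [if_pos hj, if_neg (by omega), add_zero]
      · rw [if_neg hj, zero_add, coeff_charPoly, sum_mobius_eq_ite, hbot]
        · simp only [eq_comm]
        · intro x hx
          have := hd.dim_le hdim hx
          omega
    · intro j hj
      rw [coeff_charPoly, Finset.mul_sum]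
      -- All terms in degree `j` have the same sign; `0̂` is not among them because `j ≤ d < n`.
      refine Finset.sum_nonpos fun x hx => ?_
      have hxj := (Finset.mem_filter.1 hx).2
      subst hxj
      refine hd.sign_mobius hA hdim hh hp hs fun h => ?_
      rw [h, hbot] at hj
      omega
  · intro _ A hA hd hh hp hs
    have hdim := fun (K K' : Projectivization.Subspace F (Fin n → F)) =>
      projDim_lt (K := K) (K' := K')
    have hbot : projDim (⊥ : IntersectionSemilattice A).1 = n - 1 := projDim_top
    constructor
    · ext j
      simp only [coeff_add, finsetSum_coeff, coeff_C_mul, coeff_X_pow, mul_ite, mul_one, mul_zero,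
        Finset.sum_ite_eq, Finset.mem_range, Finset.mem_Icc]
      by_cases hj : j < d + 1
      · rw [if_pos hj, if_neg (by omega), add_zero]
      · rw [if_neg hj, zero_add, coeff_reducedCharPoly, sum_mobius_eq_ite, hbot]
        · exact if_congr ⟨fun h => ⟨by omega, h⟩, fun h => h.2⟩ rfl rfl
        · intro x hx
          have := hd.dim_le hdim hx
          omega
    · intro j hj
      rw [coeff_reducedCharPoly]
      exact hd.sign_sum_mobius hA hdim hh hp hs hj
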